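/- Let $\Omega \subseteq \mathbb{C}^n$ be a domain (a nonempty connected open set) and let $(\tilde\Omega, \pi)$ be its envelope of holomorphy: $\tilde\Omega$ is a connected Stein manifold, $\pi \colon \tilde\Omega \to \mathbb{C}^n$ is a locally biholomorphic map, and there is given a holomorphic inclusion $\alpha \colon \Omega \to \tilde\Omega$ such that $\pi \circ \alpha$ is the identity on $\Omega$ and each holomorphic function $f$ on $\Omega$ has a unique holomorphic extension $F_f$ on $\tilde\Omega$, i.e. $f = F_f \circ \alpha$. Let $\Omega' = \pi(\tilde\Omega)$, an open subset of $\mathbb{C}^n$, and let $i = \pi \circ \alpha \colon \Omega \to \Omega'$ be the inclusion. Suppose that 1. $\pi \colon \tilde\Omega \to \Omega'$ is a covering map, 2. the fundamental group $\pi_1(\Omega')$ is nilpotent, and 3. for every abelian group $G$ the homomorphism $i^* \colon H^1(\Omega'; G) \to H^1(\Omega; G)$ of singular cohomology groups is injective. Then the envelope of holomorphy $(\tilde\Omega, \pi)$ is schlicht, i.e. $\pi \colon \tilde\Omega \to \Omega'$ is biholomorphic. -/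

import Mathlib

open scoped Manifold ContDiff

noncomputable section

/-! ### Singular cohomology of a topological space -/

namespace SingularCohomology

/-- Singular `k`-simplices of `X`. -/
abbrev Simplex (k : ℕ) (X : Type*) [TopologicalSpace X] : Type _ :=
  C(stdSimplex ℝ (Fin (k + 1)), X)

/-- The inclusion `Δ^k → Δ^(k+1)` of the `j`-th face, opposite to the `j`-th vertex. -/
def face (k : ℕ) (j : Fin (k + 2)) :
    C(stdSimplex ℝ (Fin (k + 1)), stdSimplex ℝ (Fin (k + 2))) :=
  ⟨stdSimplex.map j.succAbove, stdSimplex.continuous_map _⟩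

/-- Singular `k`-cochains of `X` with coefficients in `G`: homomorphisms to `G` from the free
abelian group on the singular `k`-simplices, that is, functions on the singular simplices. -/
abbrev Cochain (k : ℕ) (X : Type*) [TopologicalSpace X] (G : Type*) : Type _ :=
  Simplex k X → G

variable {X Y : Type*} [TopologicalSpace X] [TopologicalSpace Y] (G : Type*) [AddCommGroup G]

/-- The coboundary operator
`(δ c)(σ) = ∑ j, (-1) ^ j • c (σ restricted to the j-th face)`. -/
def coboundary (k : ℕ) (X : Type*) [TopologicalSpace X] (G : Type*) [AddCommGroup G] :
    Cochain k X G →+ Cochain (k + 1) X G where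
  toFun c σ := ∑ j : Fin (k + 2), (-1 : ℤ) ^ (j : ℕ) • c (σ.comp (face k j))
  map_zero' := by ext σ; simp
  map_add' c d := by ext σ; simp [Finset.sum_add_distrib]

/-- The group of singular `k`-cocycles. -/
def cocycles (k : ℕ) (X : Type*) [TopologicalSpace X] (G : Type*) [AddCommGroup G] :
    AddSubgroup (Cochain k X G) :=
  (coboundary k X G).ker

/-- The group of singular `k`-coboundaries. -/
def coboundaries : (k : ℕ) → (X : Type*) → [TopologicalSpace X] → (G : Type*) →
    [AddCommGroup G] → AddSubgroup (Cochain k X G)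
  | 0, _, _, _, _ => ⊥
  | k + 1, X, _, G, _ => (coboundary k X G).range

/-- The `k`-th singular cohomology group `H^k(X; G)`: cocycles modulo coboundaries. -/
abbrev H (k : ℕ) (X : Type*) [TopologicalSpace X] (G : Type*) [AddCommGroup G] : Type _ :=
  cocycles k X G ⧸ (coboundaries k X G).addSubgroupOf (cocycles k X G)

/-- Pullback of cochains along a continuous map. -/
def cochainMap (k : ℕ) (f : C(X, Y)) : Cochain k Y G →+ Cochain k X G where
  toFun c σ := c (f.comp σ)
  map_zero' := rfl
  map_add' _ _ := rfl

theorem coboundary_cochainMap (k : ℕ) (f : C(X, Y)) (c : Cochain k Y G) :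
    coboundary k X G (cochainMap G k f c) = cochainMap G (k + 1) f (coboundary k Y G c) := rfl

theorem cochainMap_mem_cocycles (k : ℕ) (f : C(X, Y)) (c : Cochain k Y G)
    (hc : c ∈ cocycles k Y G) : cochainMap G k f c ∈ cocycles k X G := by
  rw [cocycles, AddMonoidHom.mem_ker] at hc ⊢
  rw [coboundary_cochainMap, hc, map_zero]

theorem cochainMap_mem_coboundaries (k : ℕ) (f : C(X, Y)) (c : Cochain k Y G)
    (hc : c ∈ coboundaries k Y G) : cochainMap G k f c ∈ coboundaries k X G := by
  cases k with
  | zero =>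
    rw [coboundaries, AddSubgroup.mem_bot] at hc ⊢
    rw [hc, map_zero]
  | succ k =>
    rw [coboundaries] at hc ⊢
    obtain ⟨b, rfl⟩ := hc
    exact ⟨cochainMap G k f b, coboundary_cochainMap G k f b⟩

/-- Pullback of cocycles along a continuous map. -/
def cocyclesMap (k : ℕ) (f : C(X, Y)) : cocycles k Y G →+ cocycles k X G :=
  ((cochainMap G k f).comp (cocycles k Y G).subtype).codRestrict (cocycles k X G)
    fun c => cochainMap_mem_cocycles G k f c c.2

/-- The homomorphism `f^* : H^k(Y; G) → H^k(X; G)` induced by a continuous map `f : X → Y`. -/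
def map (k : ℕ) (f : C(X, Y)) : H k Y G →+ H k X G :=
  QuotientAddGroup.map _ _ (cocyclesMap G k f) fun c hc =>
    cochainMap_mem_coboundaries G k f c hc

end SingularCohomology

/-! ### Stein manifolds and envelopes of holomorphy -/

section Complex

open TopologicalSpace

/-- The space `ℂⁿ`. -/
abbrev CSpace (n : ℕ) : Type := EuclideanSpace ℂ (Fin n)

variable {n : ℕ} {M : Type*} [TopologicalSpace M] [ChartedSpace (CSpace n) M]

/-- A map between complex manifolds of dimension `n` is holomorphic if it is complex analytic in
charts. -/
def IsHolomorphicMap (n : ℕ) {M N : Type*} [TopologicalSpace M] [ChartedSpace (CSpace n) M]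
    [TopologicalSpace N] [ChartedSpace (CSpace n) N] (f : M → N) : Prop :=
  ContMDiff 𝓘(ℂ, CSpace n) 𝓘(ℂ, CSpace n) ω f

/-- Holomorphic functions on a complex manifold of dimension `n`. -/
def IsHolomorphicFun (n : ℕ) {M : Type*} [TopologicalSpace M] [ChartedSpace (CSpace n) M]
    (f : M → ℂ) : Prop :=
  ContMDiff 𝓘(ℂ, CSpace n) 𝓘(ℂ, ℂ) ω f

/-- Locally biholomorphic maps between complex manifolds of dimension `n`. -/
def IsLocallyBiholomorphic (n : ℕ) {M N : Type*} [TopologicalSpace M] [ChartedSpace (CSpace n) M]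
    [TopologicalSpace N] [ChartedSpace (CSpace n) N] (f : M → N) : Prop :=
  IsLocalDiffeomorph 𝓘(ℂ, CSpace n) 𝓘(ℂ, CSpace n) ω f

/-- Biholomorphic maps between complex manifolds of dimension `n`. -/
def IsBiholomorphic (n : ℕ) {M N : Type*} [TopologicalSpace M] [ChartedSpace (CSpace n) M]
    [TopologicalSpace N] [ChartedSpace (CSpace n) N] (f : M → N) : Prop :=
  ∃ Φ : Diffeomorph 𝓘(ℂ, CSpace n) 𝓘(ℂ, CSpace n) M N ω, ⇑Φ = f

/-- The holomorphically convex hull in `M` of a set `K`: the points `x` with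
`|f x| ≤ sup_K |f|` for every holomorphic function `f` on `M`. -/
def holomorphicHull (n : ℕ) {M : Type*} [TopologicalSpace M] [ChartedSpace (CSpace n) M]
    (K : Set M) : Set M :=
  {x | ∀ f : M → ℂ, IsHolomorphicFun n f → ∀ C : ℝ, (∀ y ∈ K, ‖f y‖ ≤ C) → ‖f x‖ ≤ C}

/-- Stein manifolds of dimension `n`: (Hausdorff, second countable) complex manifolds that are
holomorphically convex and holomorphically separable. -/
structure IsSteinManifold (n : ℕ) (M : Type*) [TopologicalSpace M] [ChartedSpace (CSpace n) M] :
    Prop where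
  t2 : T2Space M
  secondCountable : SecondCountableTopology M
  isManifold : IsManifold 𝓘(ℂ, CSpace n) ω M
  holomorphicallyConvex : ∀ K : Set M, IsCompact K → IsCompact (holomorphicHull n K)
  holomorphicallySeparable : ∀ x y : M, x ≠ y → ∃ f : M → ℂ, IsHolomorphicFun n f ∧ f x ≠ f y

/-- `(M, p)`, together with `a : Ω → M`, is an envelope of holomorphy of `Ω ⊆ ℂⁿ`. -/
structure IsEnvelopeOfHolomorphy (Ω : Opens (CSpace n)) (p : M → CSpace n) (a : Ω → M) :
    Prop where
  isStein : IsSteinManifold n M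
  connected : ConnectedSpace M
  locallyBiholomorphic : IsLocallyBiholomorphic n p
  holomorphic : IsHolomorphicMap n a
  proj_comp : ∀ z : Ω, p (a z) = z
  extension : ∀ f : Ω → ℂ, IsHolomorphicFun n f →
    ∃! F : M → ℂ, IsHolomorphicFun n F ∧ F ∘ a = f

namespace IsEnvelopeOfHolomorphy

variable {Ω : Opens (CSpace n)} {p : M → CSpace n} {a : Ω → M}

/-- The image `Ω' = p(M)` of the envelope, an open subset of `ℂⁿ`. -/
def image (h : IsEnvelopeOfHolomorphy Ω p a) : Opens (CSpace n) :=
  ⟨Set.range p, IsLocalDiffeomorph.isOpen_range h.locallyBiholomorphic⟩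

/-- The map `p`, regarded as a map from the envelope onto its image `Ω'`. -/
def proj (h : IsEnvelopeOfHolomorphy Ω p a) (x : M) : h.image :=
  ⟨p x, Set.mem_range_self x⟩

theorem continuous_proj (h : IsEnvelopeOfHolomorphy Ω p a) : Continuous h.proj :=
  (IsLocalDiffeomorph.contMDiff h.locallyBiholomorphic).continuous.subtype_mk _

/-- The map `i = p ∘ a : Ω → Ω'`. -/
def incl (h : IsEnvelopeOfHolomorphy Ω p a) : C(Ω, h.image) :=
  ⟨h.proj ∘ a, h.continuous_proj.comp (ContMDiff.continuous h.holomorphic)⟩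

/-- The envelope is schlicht if `p : M → Ω'` is biholomorphic. -/
def IsSchlicht (h : IsEnvelopeOfHolomorphy Ω p a) : Prop :=
  IsBiholomorphic n h.proj

end IsEnvelopeOfHolomorphy

end Complex

end

/-! The argument is topological. A covering with path connected total space that is surjective on π₁
is injective, and an injective local biholomorphism is biholomorphic onto its image. Since `incl =
proj ∘ a`, it therefore suffices that `incl` is surjective on π₁. Let K be the image of π₁(Ω) in Γ =
π₁(Ω'). A homomorphism from Γ to an abelian group G gives a class in H¹(Ω'; G) that determines it,
so injectivity of i^* kills every homomorphism vanishing on K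
(`eq_one_of_comp_fundamentalGroup_map_eq_one`). Applied to the projection of Γ onto its
abelianization modulo the image of K, this gives K[Γ,Γ] = Γ, and nilpotency forces K = Γ
(`Subgroup.eq_top_of_sup_commutator_eq_top`). -/

open TopologicalSpace
open scoped commutatorElement

/-! ### Nilpotent groups -/

/-- In a nilpotent group, a subgroup which generates the group together with the commutator
subgroup is the whole group. -/
theorem Subgroup.eq_top_of_sup_commutator_eq_top {Γ : Type*} [Group Γ] [Group.IsNilpotent Γ]
    (K : Subgroup Γ) (hK : K ⊔ _root_.commutator Γ = ⊤) : K = ⊤ := by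
  obtain ⟨c, hc⟩ := Group.IsNilpotent.nilpotent Γ
  -- Descent along the upper central series Z_i. If K Z_{k+1} = Γ, then modulo Z_k every element is
  -- a central one times one of K, so every commutator agrees with a commutator of K. Hence [Γ,Γ]
  -- lies in K Z_k.
  have key : K ⊔ Subgroup.upperCentralSeries Γ 0 = ⊤ := by
    refine Nat.decreasingInduction' (m := 0) (n := c)
      (P := fun i => K ⊔ Subgroup.upperCentralSeries Γ i = ⊤) ?_ (Nat.zero_le c) ?_
    · intro k _ _ ih
      rw [eq_top_iff, ← hK]
      refine sup_le le_sup_left ?_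
      set Z := Subgroup.upperCentralSeries Γ k with hZ
      have hcent : ∀ z ∈ Subgroup.upperCentralSeries Γ (k + 1), ∀ y : Γ ⧸ Z,
          Commute (QuotientGroup.mk' Z z) y := by
        intro z hz y
        obtain ⟨y, rfl⟩ := QuotientGroup.mk'_surjective Z y
        have := (Subgroup.mem_upperCentralSeries_succ_iff).1 hz y
        rw [← commutatorElement_eq_one_iff_commute, ← map_commutatorElement]
        exact (QuotientGroup.eq_one_iff _).2 this
      have hmem : ∀ g : Γ, ∃ h ∈ K, ∃ z ∈ Subgroup.upperCentralSeries Γ (k + 1), h * z = g :=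
        fun g => Subgroup.mem_sup_of_normal_right.1 (ih ▸ Subgroup.mem_top g)
      rw [commutator_eq_closure, Subgroup.closure_le]
      rintro _ ⟨g₁, g₂, rfl⟩
      obtain ⟨h₁, hh₁, z₁, hz₁, rfl⟩ := hmem g₁
      obtain ⟨h₂, hh₂, z₂, hz₂, rfl⟩ := hmem g₂
      have : QuotientGroup.mk' Z ⁅h₁ * z₁, h₂ * z₂⁆ = QuotientGroup.mk' Z ⁅h₁, h₂⁆ := by
        simp only [commutatorElement_def, map_mul, map_inv]
        have e₁ := hcent z₁ hz₁
        have e₂ := hcent z₂ hz₂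
        generalize QuotientGroup.mk' Z z₁ = u at *
        generalize QuotientGroup.mk' Z z₂ = v at *
        generalize QuotientGroup.mk' Z h₁ = x
        generalize QuotientGroup.mk' Z h₂ = y
        calc _ = x * u * (y * v) * (x * u)⁻¹ * (y * v)⁻¹ := by group
          _ = x * (u * (y * v) * u⁻¹) * x⁻¹ * (y * v)⁻¹ := by group
          _ = x * y * (v * x⁻¹ * v⁻¹) * y⁻¹ := by rw [(e₁ _).mul_inv_cancel]; group
          _ = x * y * x⁻¹ * y⁻¹ := by rw [(e₂ _).mul_inv_cancel]
      have hmemZ := QuotientGroup.eq.1 this.symm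
      rw [SetLike.mem_coe, ← mul_inv_cancel_left ⁅h₁, h₂⁆ ⁅h₁ * z₁, h₂ * z₂⁆]
      exact Subgroup.mul_mem_sup (K.mul_mem (K.mul_mem (K.mul_mem hh₁ hh₂) (K.inv_mem hh₁))
        (K.inv_mem hh₂)) hmemZ
    · rw [hc, sup_top_eq]
  simpa using key

/-! ### Coverings and monodromy -/

/-- A covering map with path connected total space which induces a surjection of fundamental
groups is injective. -/
theorem IsCoveringMap.injective_of_surjective_fundamentalGroup_map {E X : Type*}
    [TopologicalSpace E] [TopologicalSpace X] [PathConnectedSpace E] {q : E → X}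
    (cov : IsCoveringMap q) (e : E)
    (hsurj : Function.Surjective (FundamentalGroup.map ⟨q, cov.continuous⟩ e)) :
    Function.Injective q := by
  intro x y hxy
  let f : C(E, X) := ⟨q, cov.continuous⟩
  let γx : Path.Homotopic.Quotient e x := .mk (PathConnectedSpace.somePath e x)
  let γy : Path.Homotopic.Quotient e y := .mk (PathConnectedSpace.somePath e y)
  -- The loop q(γx)q(γy)⁻¹ is the image of a loop δ at `e`, so its lift from `e` closes up.
  -- Following it by q(γy) leads to `y`, but the composite is homotopic to q(γx), whose lift ends at
  -- `x`.
  obtain ⟨δ, hδ⟩ := hsurj (FundamentalGroup.fromPath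
    ((γx.map f).trans ((γy.map f).symm.cast hxy rfl)))
  let δ' : Path.Homotopic.Quotient e e := δ
  have hδ' : δ'.map f = (γx.map f).trans ((γy.map f).symm.cast hxy rfl) := hδ
  have h₁ : cov.monodromy (γx.map f) ⟨e, rfl⟩ = ⟨x, rfl⟩ := cov.monodromy_map γx
  have h₂ : cov.monodromy (δ'.map f) ⟨e, rfl⟩ = ⟨e, rfl⟩ := cov.monodromy_map δ'
  have h₃ : cov.monodromy ((γy.map f).cast rfl hxy) ⟨e, rfl⟩ = ⟨y, hxy.symm⟩ :=
    cov.monodromy_eq_of_map_eq (ex := ⟨e, rfl⟩) (ey := ⟨y, hxy.symm⟩) γy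
      (((γy.map f).cast_cast rfl hxy rfl hxy.symm).trans (γy.map f).cast_rfl_rfl).symm
  have h₄ : ((γx.map f).trans ((γy.map f).symm.cast hxy rfl)).trans ((γy.map f).cast rfl hxy)
      = γx.map f := by
    have : ∀ {b u v : X} (h : u = v) (α : Path.Homotopic.Quotient b u)
        (β : Path.Homotopic.Quotient b v),
        (α.trans (β.symm.cast h rfl)).trans (β.cast rfl h) = α := by
      rintro b u v rfl α β
      simp
    exact this hxy _ _
  have h₅ := cov.monodromy_trans_apply (δ'.map f) ((γy.map f).cast rfl hxy) ⟨e, rfl⟩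
  rw [h₂, h₃, hδ', h₄, h₁] at h₅
  exact congrArg Subtype.val h₅

/-- Makes path classes between two given points of a simplex unique. -/
instance stdSimplex.instContractibleSpace {ι : Type*} [Fintype ι] [Nonempty ι] :
    ContractibleSpace (stdSimplex ℝ ι) := by
  classical
  exact (convex_stdSimplex ℝ ι).contractibleSpace
    ⟨_, single_mem_stdSimplex ℝ (Classical.arbitrary ι)⟩

/-! ### First cohomology and the fundamental group -/

namespace SingularCohomology

variable {X Y : Type*} [TopologicalSpace X] [TopologicalSpace Y] {G : Type*} [AddCommGroup G]

/-- The homotopy class of paths joining two points of a simply connected space. -/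
noncomputable def pathClass [SimplyConnectedSpace X] (x y : X) : Path.Homotopic.Quotient x y :=
  .mk (PathConnectedSpace.somePath x y)

section Holonomy

variable {b : X} (τ : ∀ x : X, Path.Homotopic.Quotient b x)
  (φ : FundamentalGroup X b →* Multiplicative G)

/-- The value of a homomorphism `φ : π₁(X, b) → G` on a class of paths, closed up to a loop by
means of a choice `τ` of paths from the base point. -/
noncomputable def holonomy {x y : X} (γ : Path.Homotopic.Quotient x y) : G :=
  (φ (FundamentalGroup.fromPath ((τ x).trans (γ.trans (τ y).symm)))).toAdd

/-- The product of `FundamentalGroup` reverses concatenation; commutativity of `G` absorbs this. -/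
theorem toAdd_map_trans (α β : Path.Homotopic.Quotient b b) :
    (φ (FundamentalGroup.fromPath (α.trans β))).toAdd
      = (φ (FundamentalGroup.fromPath α)).toAdd + (φ (FundamentalGroup.fromPath β)).toAdd := by
  have : FundamentalGroup.fromPath (α.trans β)
      = FundamentalGroup.fromPath β * FundamentalGroup.fromPath α := rfl
  rw [this, map_mul, toAdd_mul, add_comm]

theorem holonomy_trans {x y z : X} (γ : Path.Homotopic.Quotient x y)
    (γ' : Path.Homotopic.Quotient y z) :
    holonomy τ φ (γ.trans γ') = holonomy τ φ γ + holonomy τ φ γ' := by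
  rw [holonomy, holonomy, holonomy, ← toAdd_map_trans]
  congr 3
  simp only [Path.Homotopic.Quotient.trans_assoc]
  rw [← Path.Homotopic.Quotient.trans_assoc (τ y).symm (τ y)]
  simp

theorem holonomy_cast {x y x' y' : X} (γ : Path.Homotopic.Quotient x y) (hx : x' = x)
    (hy : y' = y) : holonomy τ φ (γ.cast hx hy) = holonomy τ φ γ := by
  subst hx hy
  rw [Path.Homotopic.Quotient.cast_rfl_rfl]

/-- The homotopy class of the path in `X` traced by a singular `1`-simplex. -/
noncomputable def edgeClass (σ : Simplex 1 X) :
    Path.Homotopic.Quotient (σ (stdSimplex.vertex 0)) (σ (stdSimplex.vertex 1)) :=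
  (pathClass (stdSimplex.vertex 0) (stdSimplex.vertex 1)).map σ

theorem edgeClass_comp (f : C(X, Y)) (σ : Simplex 1 X) :
    edgeClass (f.comp σ) = (edgeClass σ).map f := by
  rw [edgeClass, Path.Homotopic.Quotient.map_comp]
  rfl

/-- The singular `1`-cochain defined by the holonomy. -/
noncomputable def holonomyCochain : Cochain 1 X G := fun σ => holonomy τ φ (edgeClass σ)

theorem face_vertex (k : ℕ) (j : Fin (k + 2)) (i : Fin (k + 1)) :
    face k j (stdSimplex.vertex i) = stdSimplex.vertex (j.succAbove i) :=
  stdSimplex.map_vertex _ _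

/-- In a simply connected `S`, the path class from s to u is the concatenation through any t. For a
2-simplex this is the cocycle identity. -/
theorem holonomy_map_trans {S : Type*} [TopologicalSpace S] [SimplyConnectedSpace S] (σ : C(S, X))
    (s t u : S) : holonomy τ φ ((pathClass s u).map σ)
      = holonomy τ φ ((pathClass s t).map σ) + holonomy τ φ ((pathClass t u).map σ) := by
  rw [← holonomy_trans, Subsingleton.elim (pathClass s u) ((pathClass s t).trans (pathClass t u))]
  congr 1
  exact (FundamentalGroupoid.map σ).map_comp
    (X := ⟨s⟩) (Y := ⟨t⟩) (Z := ⟨u⟩) (pathClass s t) (pathClass t u)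

theorem holonomyCochain_face (σ : Simplex 2 X) (j : Fin 3) (s t : stdSimplex ℝ (Fin 3))
    (hs : face 1 j (stdSimplex.vertex 0) = s) (ht : face 1 j (stdSimplex.vertex 1) = t) :
    -- Endpoints given as variables with equations let `subst` replace transport between path types.
    holonomyCochain τ φ (σ.comp (face 1 j)) = holonomy τ φ ((pathClass s t).map σ) := by
  subst hs ht
  rw [holonomyCochain, edgeClass_comp]
  congr 2
  exact Subsingleton.elim _ _

theorem holonomyCochain_mem_cocycles : holonomyCochain τ φ ∈ cocycles 1 X G := by
  rw [cocycles, AddMonoidHom.mem_ker]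
  funext σ
  change ∑ j : Fin 3, (-1 : ℤ) ^ (j : ℕ) • holonomyCochain τ φ (σ.comp (face 1 j)) = 0
  rw [Fin.sum_univ_three,
    holonomyCochain_face τ φ σ 0 (stdSimplex.vertex 1) (stdSimplex.vertex 2)
      (face_vertex _ _ _) (face_vertex _ _ _),
    holonomyCochain_face τ φ σ 1 (stdSimplex.vertex 0) (stdSimplex.vertex 2)
      (face_vertex _ _ _) (face_vertex _ _ _),
    holonomyCochain_face τ φ σ 2 (stdSimplex.vertex 0) (stdSimplex.vertex 1)
      (face_vertex _ _ _) (face_vertex _ _ _),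
    holonomy_map_trans τ φ σ (stdSimplex.vertex 0) (stdSimplex.vertex 1) (stdSimplex.vertex 2)]
  simp

end Holonomy

/-- The value of the coboundary of a `0`-cochain on a `1`-simplex is the difference of the values
at its endpoints. -/
theorem coboundary_zero_apply (g : Cochain 0 X G) (σ : Simplex 1 X) :
    coboundary 0 X G g σ = g (.const _ (σ (stdSimplex.vertex 1)))
      - g (.const _ (σ (stdSimplex.vertex 0))) := by
  change ∑ j : Fin 2, (-1 : ℤ) ^ (j : ℕ) • g (σ.comp (face 0 j)) = _
  -- The face opposite vertex `j` of an edge is the other vertex, so the positive sign falls on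
  -- vertex 1.
  have h : ∀ j, σ.comp (face 0 j) = .const _ (σ (stdSimplex.vertex (j.succAbove 0))) := by
    intro j
    ext s
    rw [← face_vertex, Subsingleton.elim s (stdSimplex.vertex 0)]
    rfl
  rw [Fin.sum_univ_two, h, h]
  simp [sub_eq_add_neg]

/-- Every homotopy class of paths is traced by a singular `1`-simplex. -/
theorem exists_edgeClass_eq {x y : X} (γ : Path.Homotopic.Quotient x y) :
    ∃ (σ : Simplex 1 X) (hx : x = σ (stdSimplex.vertex 0)) (hy : y = σ (stdSimplex.vertex 1)),
      (edgeClass σ).cast hx hy = γ := by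
  obtain ⟨γ⟩ := γ
  let e : C(stdSimplex ℝ (Fin 2), unitInterval) := stdSimplexHomeomorphUnitInterval
  refine ⟨γ.toContinuousMap.comp e, γ.source.symm, γ.target.symm, ?_⟩
  -- The interval is simply connected, so the edge of the simplex maps to the class of the identity
  -- path, whose image under `γ` is `γ`.
  let ι : Path (0 : unitInterval) 1 := ⟨.id _, rfl, rfl⟩
  have h : (pathClass (stdSimplex.vertex 0) (stdSimplex.vertex 1)).map e
      = Path.Homotopic.Quotient.mk ι := by
    have : ContractibleSpace unitInterval :=
      (convex_Icc (0 : ℝ) 1).contractibleSpace ⟨0, by simp⟩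
    exact Subsingleton.elim _ _
  have h' : edgeClass (γ.toContinuousMap.comp e)
      = (Path.Homotopic.Quotient.mk ι).map γ.toContinuousMap := by
    rw [edgeClass, Path.Homotopic.Quotient.map_comp, h]
    rfl
  rw [h']
  rfl

variable [PathConnectedSpace X] [PathConnectedSpace Y]

/-- If `f : X → Y` induces an injective map on `H¹(-; G)`, then a homomorphism from `π₁(Y)` to `G`
which vanishes on the image of `π₁(X)` is trivial. -/
theorem eq_one_of_comp_fundamentalGroup_map_eq_one (f : C(X, Y)) (x₀ : X)
    (hinj : Function.Injective (map G 1 f))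
    (φ : FundamentalGroup Y (f x₀) →* Multiplicative G)
    (hφ : ∀ α, φ (FundamentalGroup.map f x₀ α) = 1) : φ = 1 := by
  let τ (y : Y) : Path.Homotopic.Quotient (f x₀) y := .mk (PathConnectedSpace.somePath _ y)
  let ρ (x : X) : Path.Homotopic.Quotient x₀ x := .mk (PathConnectedSpace.somePath _ x)
  let c : cocycles 1 Y G := ⟨holonomyCochain τ φ, holonomyCochain_mem_cocycles τ φ⟩
  -- A primitive of the pulled-back cocycle: by `hφ` image loops have no holonomy, so holonomy along
  -- an image path depends only on its endpoints in `X`.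
  let w (x : X) : G := holonomy τ φ ((ρ x).map f)
  have map_trans {x y z : X} (α : Path.Homotopic.Quotient x y) (β : Path.Homotopic.Quotient y z) :
      (α.trans β).map f = (α.map f).trans (β.map f) :=
    (FundamentalGroupoid.map f).map_comp (X := ⟨x⟩) (Y := ⟨y⟩) (Z := ⟨z⟩) α β
  have hloop (α : Path.Homotopic.Quotient x₀ x₀) : holonomy τ φ (α.map f) = 0 := by
    have h : (φ (FundamentalGroup.fromPath (α.map f))).toAdd = 0 :=
      congrArg Multiplicative.toAdd (hφ α)
    rw [holonomy, toAdd_map_trans, toAdd_map_trans, h, zero_add, ← toAdd_map_trans,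
      Path.Homotopic.Quotient.trans_symm]
    exact congrArg Multiplicative.toAdd (map_one φ)
  have hw {x y : X} (γ : Path.Homotopic.Quotient x y) : holonomy τ φ (γ.map f) = w y - w x := by
    have h₁ : ((ρ x).trans (γ.trans (ρ y).symm)).trans (ρ y) = (ρ x).trans γ := by simp
    have h₂ := congrArg (fun α => holonomy τ φ (α.map f)) h₁
    simp only [map_trans _ (ρ y), map_trans (ρ x) γ, holonomy_trans, hloop, zero_add] at h₂
    rw [eq_sub_iff_add_eq, add_comm]
    exact h₂.symm
  have hpull : map G 1 f (QuotientAddGroup.mk c) = 0 := by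
    refine (QuotientAddGroup.eq_zero_iff _).2 ?_
    refine AddSubgroup.mem_addSubgroupOf.2 ⟨fun s => w (s (stdSimplex.vertex 0)), ?_⟩
    funext σ
    rw [coboundary_zero_apply]
    change _ = holonomy τ φ (edgeClass (f.comp σ))
    rw [edgeClass_comp, hw]
    rfl
  have hc : (QuotientAddGroup.mk c : H 1 Y G) = 0 := hinj (hpull.trans (map_zero _).symm)
  obtain ⟨g, hg⟩ := AddSubgroup.mem_addSubgroupOf.1 ((QuotientAddGroup.eq_zero_iff c).1 hc)
  -- A coboundary vanishes on edges with equal endpoints, and every loop is such an edge.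
  have hzero (γ : Path.Homotopic.Quotient (f x₀) (f x₀)) : holonomy τ φ γ = 0 := by
    obtain ⟨σ, hx, hy, rfl⟩ := exists_edgeClass_eq γ
    rw [holonomy_cast]
    have h : coboundary 0 Y G g σ = holonomy τ φ (edgeClass σ) := congrFun hg σ
    rw [← h, coboundary_zero_apply, ← hx, ← hy, sub_self]
  refine MonoidHom.ext fun γ => ?_
  have h := hzero γ
  -- Holonomy conjugates the loop by `τ (f x₀)`, which has no effect in the abelian group `G`.
  rw [holonomy, toAdd_map_trans, toAdd_map_trans, add_left_comm, ← toAdd_map_trans,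
    Path.Homotopic.Quotient.trans_symm] at h
  have h₁ : (φ (FundamentalGroup.fromPath (Path.Homotopic.Quotient.refl (f x₀)))).toAdd = 0 :=
    congrArg Multiplicative.toAdd (map_one φ)
  rw [h₁, add_zero] at h
  exact h

/-- If `f : X → Y` induces injective maps on `H¹(-; G)` for all abelian groups `G` and `π₁(Y)` is
nilpotent, then `f` induces a surjective map on fundamental groups. -/
theorem surjective_fundamentalGroup_map {X : Type*} {Y : Type} [TopologicalSpace X]
    [TopologicalSpace Y] [PathConnectedSpace X] [PathConnectedSpace Y] (f : C(X, Y)) (x₀ : X)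
    [Group.IsNilpotent (FundamentalGroup Y (f x₀))]
    (hinj : ∀ (G : Type) [AddCommGroup G], Function.Injective (map G 1 f)) :
    Function.Surjective (FundamentalGroup.map f x₀) := by
  rw [← MonoidHom.range_eq_top]
  refine Subgroup.eq_top_of_sup_commutator_eq_top _ ?_
  set Γ := FundamentalGroup Y (f x₀)
  set K := (FundamentalGroup.map f x₀).range
  let N := K.map (Abelianization.of (G := Γ))
  -- The coefficient group is the cokernel of K → Γᵃᵇ; it lies in `Type` because `Y` does.
  let φ : Γ →* Multiplicative (Additive (Abelianization Γ ⧸ N)) :=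
    (QuotientGroup.mk' N).comp Abelianization.of
  have hφ : φ = 1 := eq_one_of_comp_fundamentalGroup_map_eq_one f x₀ (hinj _) φ fun α =>
    (QuotientGroup.eq_one_iff _).2 ⟨_, ⟨α, rfl⟩, rfl⟩
  rw [eq_top_iff]
  intro γ _
  have h : (QuotientGroup.mk' N) (Abelianization.of γ) = 1 := DFunLike.congr_fun hφ γ
  obtain ⟨κ, hκ, hκγ⟩ := (QuotientGroup.eq_one_iff _).1 h
  have h' : κ⁻¹ * γ ∈ _root_.commutator Γ := by
    rw [← Abelianization.ker_of, MonoidHom.mem_ker, map_mul, map_inv, hκγ, inv_mul_cancel]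
  rw [← mul_inv_cancel_left κ γ]
  exact Subgroup.mul_mem_sup hκ h'

end SingularCohomology

/-! ### From injectivity to schlichtness -/

namespace IsEnvelopeOfHolomorphy

variable {n : ℕ} {M : Type*} [TopologicalSpace M] [ChartedSpace (CSpace n) M]
  {Ω : Opens (CSpace n)} {p : M → CSpace n} {a : Ω → M}

/-- Near each point the global inverse coincides, by injectivity, with a local holomorphic inverse
of `p`. -/
theorem isSchlicht_of_injective (h : IsEnvelopeOfHolomorphy Ω p a)
    (hinj : Function.Injective h.proj) : h.IsSchlicht := by
  have hbij : Function.Bijective h.proj :=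
    ⟨hinj, by rintro ⟨_, x, rfl⟩; exact ⟨x, rfl⟩⟩
  let e := Equiv.ofBijective h.proj hbij
  refine ⟨⟨e, fun x => ?_, fun y => ?_⟩, rfl⟩
  · exact contMDiffAt_iff_target.2 ⟨h.continuous_proj.continuousAt,
      IsLocalDiffeomorph.contMDiff h.locallyBiholomorphic x⟩
  · obtain ⟨Φ, hxΦ, hΦ⟩ := h.locallyBiholomorphic (e.symm y)
    have hp (z : h.image) : p (e.symm z) = z := congrArg Subtype.val (e.apply_symm_apply z)
    have hy : (y : CSpace n) ∈ Φ.target := by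
      rw [← hp y, hΦ hxΦ]
      exact Φ.map_source hxΦ
    have hΦs : ContMDiffAt 𝓘(ℂ, CSpace n) 𝓘(ℂ, CSpace n) ω Φ.symm (y : CSpace n) :=
      Φ.symm.contMDiffOn.contMDiffAt (Φ.open_target.mem_nhds hy)
    refine (hΦs.comp y contMDiff_subtype_val.contMDiffAt).congr_of_eventuallyEq ?_
    filter_upwards [continuous_subtype_val.continuousAt.preimage_mem_nhds
      (Φ.open_target.mem_nhds hy)] with z hz
    refine hinj (Subtype.ext ?_)
    change p (e.symm z) = p (Φ.symm z)
    rw [hp]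
    exact ((hΦ (Φ.map_target hz)).trans (Φ.right_inv hz)).symm

end IsEnvelopeOfHolomorphy

theorem theorem3 {n : ℕ} (Ω : TopologicalSpace.Opens (CSpace n))
    (hΩ : IsConnected (Ω : Set (CSpace n)))
    {M : Type*} [TopologicalSpace M] [ChartedSpace (CSpace n) M]
    (p : M → CSpace n) (a : Ω → M) (h : IsEnvelopeOfHolomorphy Ω p a)
    (hcov : IsCoveringMap h.proj)
    (b : h.image) (hnil : Group.IsNilpotent (FundamentalGroup h.image b))
    (hinj : ∀ (G : Type) [AddCommGroup G],
      Function.Injective (SingularCohomology.map G 1 h.incl)) :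
    h.IsSchlicht := by
  have := h.connected
  have : LocallyPathConnectedSpace M := ChartedSpace.locallyPathConnectedSpace (CSpace n) M
  have : PathConnectedSpace M := pathConnectedSpace_iff_connectedSpace.2 inferInstance
  have : PathConnectedSpace Ω :=
    isPathConnected_iff_pathConnectedSpace.1 (Ω.isOpen.isConnected_iff_isPathConnected.1 hΩ)
  have : PathConnectedSpace h.image :=
    Function.Surjective.pathConnectedSpace (f := h.proj)
      (by rintro ⟨_, x, rfl⟩; exact ⟨x, rfl⟩) h.continuous_proj
  obtain ⟨z⟩ : Nonempty Ω := inferInstance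
  have : Group.IsNilpotent (FundamentalGroup h.image (h.incl z)) :=
    Group.nilpotent_of_mulEquiv
      (FundamentalGroup.fundamentalGroupMulEquivOfPathConnected b (h.incl z))
  have hsurj := SingularCohomology.surjective_fundamentalGroup_map h.incl z hinj
  refine h.isSchlicht_of_injective
    (hcov.injective_of_surjective_fundamentalGroup_map (a z) fun γ => ?_)
  -- As `h.incl` factors through `h.proj`, the loop `a ∘ δ` is a preimage.
  obtain ⟨δ, rfl⟩ := hsurj γ
  refine ⟨FundamentalGroup.map ⟨a, ContMDiff.continuous h.holomorphic⟩ z δ, ?_⟩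
  let δ' : Path.Homotopic.Quotient z z := δ
  exact (δ'.map_comp (f := ⟨a, ContMDiff.continuous h.holomorphic⟩)
    (g := ⟨h.proj, h.continuous_proj⟩)).symm
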